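/- For $d\ge 1$ let $\mathcal P_d\subset\mathbb R^d$ be the pellytope, i.e. the Newton polytope (the convex hull of the exponent vectors of the monomials that occur) of the polynomial \[ \prod_{i=1}^{d}(1+y_i)\,\prod_{j=1}^{d-1}(1+y_j+y_jy_{j+1})\in\mathbb C[y_1,\dots,y_d], \] and let $\Sigma_d$ be its inner normal fan, i.e. the collection of the cones \[ \{v\in\mathbb R^d : \langle v,x\rangle\le\langle v,y\rangle \text{ for all } x\in F,\ y\in\mathcal P_d\}, \] where $F$ runs over the non-empty faces of $\mathcal P_d$ (including $\mathcal P_d$ itself). Let $e_1,\dots,e_d$ be the standard basis of $\mathbb R^d$, and let the Pell numbers be defined by $n_1=1$, $n_2=2$ and $n_k=2n_{k-1}+n_{k-2}$ for $k\ge 3$. Proposition. For every integer $d\ge 1$, $\Sigma_d$ is a simplicial fan: it is a non-empty finite collection of polyhedral cones, it contains every face of each of its cones, the intersection of any two of its cones is a face of both, and each of its cones is generated by linearly independent vectors. It has exactly $3d-1$ rays (one-dimensional cones), and these are the cones spanned by the $3d-1$ vectors \[ e_1,\dots,e_d,\quad -e_1,\dots,-e_d,\quad e_1-e_2,\ \dots,\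 e_{d-1}-e_d . \] It has exactly $n_{d+1}$ maximal cones (with respect to inclusion). -/

import Mathlib

open scoped Matrix

namespace Pellytope

/-- The Newton polytope of a polynomial `p` in `d` variables: the convex hull in `ℝ^d` of the
exponent vectors of the monomials that occur in `p` with non-zero coefficient. -/
def newtonPolytope {d : ℕ} {K : Type*} [CommSemiring K] (p : MvPolynomial (Fin d) K) :
    Set (Fin d → ℝ) :=
  convexHull ℝ ((fun m : Fin d →₀ ℕ => fun i : Fin d => (m i : ℝ)) '' (p.support : Set _))

/-- The polynomial `∏_{i=1}^d (1 + y_i) · ∏_{j=1}^{d-1} (1 + y_j + y_j y_{j+1})`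
(with variables indexed from `0`). -/
noncomputable def pellyPolynomial (d : ℕ) : MvPolynomial (Fin d) ℂ :=
  (∏ i : Fin d, (1 + MvPolynomial.X i)) *
    ∏ j : Fin (d - 1),
      (1 + MvPolynomial.X ⟨j, by omega⟩
        + MvPolynomial.X ⟨j, by omega⟩ * MvPolynomial.X ⟨j + 1, by omega⟩)

/-- The pellytope `P_d ⊆ ℝ^d`. -/
noncomputable def pellytope (d : ℕ) : Set (Fin d → ℝ) :=
  newtonPolytope (pellyPolynomial d)

/-- The Pell numbers `n_1 = 1`, `n_2 = 2`, `n_k = 2 n_{k-1} + n_{k-2}`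
(and `n_0 = 0`, which is not used). -/
def pellNumber : ℕ → ℕ
  | 0 => 0
  | 1 => 1
  | 2 => 2
  | n + 3 => 2 * pellNumber (n + 2) + pellNumber (n + 1)

/-- The face of `P` on which the linear functional `⟨w, ·⟩` attains its minimum over `P`. -/
def minFace {d : ℕ} (P : Set (Fin d → ℝ)) (w : Fin d → ℝ) : Set (Fin d → ℝ) :=
  {x ∈ P | ∀ y ∈ P, w ⬝ᵥ x ≤ w ⬝ᵥ y}

/-- The inner normal cone of `P` at `F ⊆ P`: all `v` such that `⟨v, ·⟩` attains its minimum over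
`P` at every point of `F`. -/
def innerNormalCone {d : ℕ} (P F : Set (Fin d → ℝ)) : PointedCone ℝ (Fin d → ℝ) where
  carrier := {v | ∀ x ∈ F, ∀ y ∈ P, v ⬝ᵥ x ≤ v ⬝ᵥ y}
  add_mem' := by
    intro a b ha hb x hx y hy
    rw [add_dotProduct, add_dotProduct]
    exact add_le_add (ha x hx y hy) (hb x hx y hy)
  zero_mem' := by
    intro x _ y _
    simp
  smul_mem' := by
    intro c v hv x hx y hy
    have h := mul_le_mul_of_nonneg_left (hv x hx y hy) c.2
    have e : ∀ z : Fin d → ℝ, (c • v) ⬝ᵥ z = (c : ℝ) * (v ⬝ᵥ z) := by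
      intro z
      exact smul_dotProduct (c : ℝ) v z
    rw [e, e]
    exact h

/-- The inner normal fan of a polytope `P`: the inner normal cones of the non-empty faces of `P`
(`P` itself is the face `minFace P 0`). -/
def innerNormalFan {d : ℕ} (P : Set (Fin d → ℝ)) : Set (PointedCone ℝ (Fin d → ℝ)) :=
  {C | ∃ w : Fin d → ℝ, (minFace P w).Nonempty ∧ C = innerNormalCone P (minFace P w)}

/-- A fan in a real vector space: a non-empty finite family of polyhedral (finitely generated)
cones that contains every face of each of its cones, and in which the intersection of any two
cones is a face of both. -/
structure IsFan {E : Type*} [AddCommGroup E] [Module ℝ E] (S : Set (PointedCone ℝ E)) : Prop where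
  nonempty : S.Nonempty
  finite : S.Finite
  polyhedral : ∀ C ∈ S, Submodule.FG C
  face_mem : ∀ C ∈ S, ∀ F : PointedCone ℝ E, F.IsFaceOf C → F ∈ S
  inter_isFaceOf : ∀ C ∈ S, ∀ D ∈ S, (C ⊓ D).IsFaceOf C ∧ (C ⊓ D).IsFaceOf D

/-- A simplicial fan: a fan each of whose cones is generated by linearly independent vectors. -/
structure IsSimplicialFan {E : Type*} [AddCommGroup E] [Module ℝ E]
    (S : Set (PointedCone ℝ E)) : Prop extends IsFan S where
  simplicial : ∀ C ∈ S, C.IsSimplicial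

/-- The rays of a family of cones: its one-dimensional members. -/
def rays {E : Type*} [AddCommGroup E] [Module ℝ E] (S : Set (PointedCone ℝ E)) :
    Set (PointedCone ℝ E) :=
  {C ∈ S | Module.finrank ℝ (Submodule.span ℝ (C : Set E)) = 1}

/-- The members of a family of cones that are maximal with respect to inclusion. -/
def maximalCones {E : Type*} [AddCommGroup E] [Module ℝ E] (S : Set (PointedCone ℝ E)) :
    Set (PointedCone ℝ E) :=
  {C | Maximal (fun D => D ∈ S) C}

/-- The vectors `e_1, …, e_d`, `-e_1, …, -e_d` and `e_1 - e_2, …, e_{d-1} - e_d` of `ℝ^d`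
(with coordinates indexed from `0`). -/
def rayVectors (d : ℕ) : Set (Fin d → ℝ) :=
  Set.range (fun i : Fin d => Pi.single i (1 : ℝ)) ∪
    Set.range (fun i : Fin d => -Pi.single i (1 : ℝ)) ∪
    Set.range (fun j : Fin (d - 1) =>
      Pi.single (⟨j, by omega⟩ : Fin d) (1 : ℝ) - Pi.single (⟨j + 1, by omega⟩ : Fin d) (1 : ℝ))

end Pellytope

/-!
The support function `h v = min ⟨v, ·⟩` of the pellytope is the sum of the support functions of the
Newton polytopes of the factors, that is, of the functions `min 0 (v i)` and
`min {0, v j, v j + v (j+1)}`. Two vectors `v` and `w` lie in a common normal cone if and only if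
`h (v + w) = h v + h w`. Since `min {0, x, x + y} = min x⁺ y⁻ - x⁻ - y⁻`, this holds if and only if
the numbers `(v i)⁻` and `min (v j)⁺ (v (j+1))⁻` are additive at `v, w`. These numbers determine the
coefficients of a distinguished expression of `v` as a non-negative combination of the `3d - 1`
vectors: `min (v j)⁺ (v (j+1))⁻` is the coefficient of `e_j - e_{j+1}`, and the rest of `v` is a
combination of the vectors `e_i` and `-e_i`. Hence the normal cones are the cones spanned by the
sets of vectors that can occur together in such an expression, and they form a simplicial fan.

A maximal such set is given by a sign vector and, at each of its sign changes `+, -` in positions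
`j, j + 1`, the choice of one of `e_j` and `-e_{j+1}` to be left out. So there are
`∑ s, 2 ^ desc s` maximal cones, and splitting this sum by the first signs gives the Pell recursion.
-/

namespace Pellytope

section ConicCoordinates

variable {𝕜 ι E : Type*} [Ring 𝕜] [LinearOrder 𝕜] [IsStrictOrderedRing 𝕜] [AddCommGroup E]
  [Module 𝕜 E]

theorem mem_hull_image_iff_exists_nonneg [Fintype ι] {r : ι → E} {S : Set ι} {v : E} :
    v ∈ PointedCone.hull 𝕜 (r '' S) ↔
      ∃ a : ι → 𝕜, 0 ≤ a ∧ Function.support a ⊆ S ∧ ∑ i, a i • r i = v := by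
  rw [PointedCone.hull, Finsupp.mem_span_image_iff_linearCombination]
  constructor
  · rintro ⟨l, hl, rfl⟩
    refine ⟨fun i => l i, fun i => (l i).2, fun i hi => hl ?_, ?_⟩
    · simpa [← Subtype.coe_ne_coe] using hi
    · rw [Finsupp.linearCombination_apply, Finsupp.sum_fintype _ _ fun i => zero_smul _ (r i)]
      rfl
  · rintro ⟨a, ha, haS, rfl⟩
    refine ⟨Finsupp.equivFunOnFinite.symm fun i => ⟨a i, ha i⟩, fun i hi => haS fun h => ?_, ?_⟩
    · simp [h] at hi
    · rw [Finsupp.linearCombination_apply, Finsupp.sum_fintype _ _ fun i => zero_smul _ (r i)]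
      rfl

/-- Vectors `r i` and a complex `Δ` of index sets such that every vector is, in exactly one way, a
non-negative combination of the `r i` supported on a member of `Δ`; the coefficients of `v` in
this combination are `c v`. In other words, the cones spanned by the members of `Δ` form a complete
simplicial fan. -/
structure IsConicCoordinates [Fintype ι] (r : ι → E) (Δ : Set (Set ι)) (c : E → ι → 𝕜) :
    Prop where
  isLowerSet : IsLowerSet Δ
  nonneg : ∀ v, 0 ≤ c v
  support_mem : ∀ v, Function.support (c v) ∈ Δ
  sum_smul : ∀ v, ∑ i, c v i • r i = v
  eq_of_support_subset : ∀ S ∈ Δ, ∀ a : ι → 𝕜, 0 ≤ a → Function.support a ⊆ S →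
    c (∑ i, a i • r i) = a

variable (𝕜) in
/-- The cones spanned by the vectors `r i` with `i` in a member of `Δ`. -/
def spannedCones (r : ι → E) (Δ : Set (Set ι)) : Set (PointedCone 𝕜 E) :=
  (fun S => PointedCone.hull 𝕜 (r '' S)) '' Δ

namespace IsConicCoordinates

variable [Fintype ι] {r : ι → E} {Δ : Set (Set ι)} {c : E → ι → 𝕜} {S T : Set ι}

theorem mem_hull_iff (h : IsConicCoordinates r Δ c) (hS : S ∈ Δ) {v : E} :
    v ∈ PointedCone.hull 𝕜 (r '' S) ↔ Function.support (c v) ⊆ S := by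
  rw [mem_hull_image_iff_exists_nonneg]
  constructor
  · rintro ⟨a, ha, haS, rfl⟩
    rwa [h.eq_of_support_subset S hS a ha haS]
  · exact fun hv => ⟨c v, h.nonneg v, hv, h.sum_smul v⟩

theorem coord_add (h : IsConicCoordinates r Δ c) (hS : S ∈ Δ) {v w : E}
    (hv : Function.support (c v) ⊆ S) (hw : Function.support (c w) ⊆ S) :
    c (v + w) = c v + c w := by
  conv_lhs => rw [← h.sum_smul v, ← h.sum_smul w, ← Finset.sum_add_distrib]
  simp only [← add_smul]
  exact h.eq_of_support_subset S hS (c v + c w) (add_nonneg (h.nonneg v) (h.nonneg w))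
    ((Function.support_add _ _).trans (Set.union_subset hv hw))

theorem coord_smul (h : IsConicCoordinates r Δ c) {t : 𝕜} (ht : 0 ≤ t) (v : E) :
    c (t • v) = t • c v := by
  conv_lhs => rw [← h.sum_smul v, Finset.smul_sum]
  simp only [← mul_smul]
  exact h.eq_of_support_subset _ (h.support_mem v) (t • c v) (smul_nonneg ht (h.nonneg v))
    fun _ hi => right_ne_zero_of_mul hi

theorem coord_generator [DecidableEq ι] (h : IsConicCoordinates r Δ c) {i : ι} (hi : {i} ∈ Δ) :
    c (r i) = Pi.single i 1 := by
  simpa [Pi.single_apply] using h.eq_of_support_subset {i} hi (Pi.single i 1)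
    (Pi.single_nonneg.2 zero_le_one) Pi.support_single_subset

theorem hull_le_hull_iff (h : IsConicCoordinates r Δ c) (hS : S ∈ Δ) (hT : T ∈ Δ) :
    PointedCone.hull 𝕜 (r '' S) ≤ PointedCone.hull 𝕜 (r '' T) ↔ S ⊆ T := by
  classical
  refine ⟨fun hle i hi => ?_, fun hST => Submodule.span_mono (Set.image_mono hST)⟩
  have hsupp := (h.mem_hull_iff hT).1 (hle (PointedCone.subset_hull (Set.mem_image_of_mem r hi)))
  rw [h.coord_generator (h.isLowerSet (Set.singleton_subset_iff.2 hi) hS)] at hsupp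
  exact hsupp (by simp)

theorem injOn_hull (h : IsConicCoordinates r Δ c) :
    Set.InjOn (fun S => PointedCone.hull 𝕜 (r '' S)) Δ := fun _ hS _ hT hST =>
  ((h.hull_le_hull_iff hS hT).1 hST.le).antisymm ((h.hull_le_hull_iff hT hS).1 hST.ge)

theorem linearIndepOn (h : IsConicCoordinates r Δ c) (hS : S ∈ Δ) : LinearIndepOn 𝕜 r S := by
  rw [linearIndepOn_iff]
  intro l hl h0
  have hlS : Function.support l ⊆ S := fun i hi => hl (Finsupp.mem_support_iff.2 hi)
  have hparts : ∑ i, (l i)⁺ • r i = ∑ i, (l i)⁻ • r i := by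
    rw [← sub_eq_zero, ← Finset.sum_sub_distrib]
    simp only [← sub_smul, posPart_sub_negPart]
    rwa [Finsupp.linearCombination_apply, Finsupp.sum_fintype _ _ fun i => zero_smul _ (r i)] at h0
  have hpos := h.eq_of_support_subset S hS (fun i => (l i)⁺) (fun i => posPart_nonneg _)
    fun i hi => hlS fun hli => hi (by simp [hli])
  have hneg := h.eq_of_support_subset S hS (fun i => (l i)⁻) (fun i => negPart_nonneg _)
    fun i hi => hlS fun hli => hi (by simp [hli])
  ext i
  rw [← posPart_sub_negPart (l i), congrFun ((hpos.symm.trans (congrArg c hparts)).trans hneg) i,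
    sub_self, Finsupp.zero_apply]

theorem hull_inf_hull (h : IsConicCoordinates r Δ c) (hS : S ∈ Δ) (hT : T ∈ Δ) :
    PointedCone.hull 𝕜 (r '' S) ⊓ PointedCone.hull 𝕜 (r '' T) =
      PointedCone.hull 𝕜 (r '' (S ∩ T)) := by
  ext v
  rw [Submodule.mem_inf, h.mem_hull_iff hS, h.mem_hull_iff hT,
    h.mem_hull_iff (h.isLowerSet Set.inter_subset_left hS), Set.subset_inter_iff]

theorem hull_isFaceOf_hull (h : IsConicCoordinates r Δ c) (hS : S ∈ Δ) (hTS : T ⊆ S) :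
    (PointedCone.hull 𝕜 (r '' T)).IsFaceOf (PointedCone.hull 𝕜 (r '' S)) := by
  have hT := h.isLowerSet hTS hS
  refine ⟨(h.hull_le_hull_iff hT hS).2 hTS, fun {x y a} hx hy ha hxy => ?_⟩
  have hax := (h.mem_hull_iff hS).1 (PointedCone.smul_mem _ ha.le hx)
  rw [h.mem_hull_iff hS] at hy
  rw [h.mem_hull_iff hT] at hxy ⊢
  rw [h.coord_add hS hax hy, h.coord_smul ha.le] at hxy
  exact fun i hi =>
    hxy (add_pos_of_pos_of_nonneg (mul_pos ha ((h.nonneg x i).lt_of_ne' hi)) (h.nonneg y i)).ne'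

theorem eq_hull_of_isFaceOf (h : IsConicCoordinates r Δ c) (hS : S ∈ Δ)
    {F : PointedCone 𝕜 E} (hF : F.IsFaceOf (PointedCone.hull 𝕜 (r '' S))) :
    F = PointedCone.hull 𝕜 (r '' {i ∈ S | r i ∈ F}) := by
  refine le_antisymm (fun v hv => ?_) (Submodule.span_le.2 ?_)
  · rw [h.mem_hull_iff (h.isLowerSet (Set.sep_subset _ _) hS)]
    have hvS := (h.mem_hull_iff hS).1 (hF.le hv)
    have hgen : ∀ i, c v i ≠ 0 → r i ∈ PointedCone.hull 𝕜 (r '' S) := fun i hi =>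
      PointedCone.subset_hull (Set.mem_image_of_mem r (hvS hi))
    have hterm : ∀ i, c v i • r i ∈ PointedCone.hull 𝕜 (r '' S) := fun i => by
      by_cases hi : c v i = 0
      · simp only [hi, zero_smul, zero_mem]
      · exact PointedCone.smul_mem _ (h.nonneg v i) (hgen i hi)
    rw [← h.sum_smul v] at hv
    intro i hi
    refine ⟨hvS hi, hF.mem_of_smul_add_mem (hgen i hi) (zero_mem _)
      ((h.nonneg v i).lt_of_ne' hi) ?_⟩
    rw [add_zero]
    exact hF.mem_of_sum_mem hterm hv i
  · rintro _ ⟨i, hi, rfl⟩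
    exact hi.2

theorem finrank_span_hull [StrongRankCondition 𝕜] (h : IsConicCoordinates r Δ c) (hS : S ∈ Δ) :
    Module.finrank 𝕜 (Submodule.span 𝕜 (PointedCone.hull 𝕜 (r '' S) : Set E)) = S.ncard := by
  classical
  have hspan : Submodule.span 𝕜 (PointedCone.hull 𝕜 (r '' S) : Set E) =
      Submodule.span 𝕜 (r '' S) :=
    le_antisymm (Submodule.span_le.2 (PointedCone.hull_le_span 𝕜 (r '' S)))
      (Submodule.span_mono PointedCone.subset_hull)
  rw [hspan, finrank_span_set_eq_card (h.linearIndepOn hS).id_image,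
    ← Set.ncard_eq_toFinset_card', (h.linearIndepOn hS).injOn.ncard_image]

end IsConicCoordinates

end ConicCoordinates

namespace IsConicCoordinates

variable {ι E : Type*} [Fintype ι] [AddCommGroup E] [Module ℝ E] {r : ι → E} {Δ : Set (Set ι)}
  {c : E → ι → ℝ}

theorem isSimplicialFan (h : IsConicCoordinates r Δ c) :
    IsSimplicialFan (spannedCones ℝ r Δ) where
  nonempty := ⟨_, _, h.support_mem 0, rfl⟩
  finite := (Set.toFinite Δ).image _
  polyhedral := by
    rintro _ ⟨S, _, rfl⟩
    exact Submodule.fg_span ((Set.toFinite S).image r)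
  face_mem := by
    rintro _ ⟨S, hS, rfl⟩ F hF
    exact ⟨_, h.isLowerSet (Set.sep_subset _ _) hS, (h.eq_hull_of_isFaceOf hS hF).symm⟩
  inter_isFaceOf := by
    rintro _ ⟨S, hS, rfl⟩ _ ⟨T, hT, rfl⟩
    beta_reduce
    rw [h.hull_inf_hull hS hT]
    exact ⟨h.hull_isFaceOf_hull hS Set.inter_subset_left,
      h.hull_isFaceOf_hull hT Set.inter_subset_right⟩
  simplicial := by
    rintro _ ⟨S, hS, rfl⟩
    exact .hull ((Set.toFinite S).image r) (h.linearIndepOn hS).id_image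

theorem rays_spannedCones (h : IsConicCoordinates r Δ c) (hr : ∀ i, {i} ∈ Δ) :
    rays (spannedCones ℝ r Δ) = Set.range fun i => PointedCone.hull ℝ {r i} := by
  ext C
  constructor
  · rintro ⟨⟨S, hS, rfl⟩, hdim⟩
    rw [h.finrank_span_hull hS, Set.ncard_eq_one] at hdim
    obtain ⟨i, rfl⟩ := hdim
    exact ⟨i, by simp only [Set.image_singleton]⟩
  · rintro ⟨i, rfl⟩
    beta_reduce
    rw [← Set.image_singleton]
    exact ⟨⟨{i}, hr i, rfl⟩, (h.finrank_span_hull (hr i)).trans (Set.ncard_singleton i)⟩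

theorem ncard_rays_spannedCones (h : IsConicCoordinates r Δ c) (hr : ∀ i, {i} ∈ Δ) :
    (rays (spannedCones ℝ r Δ)).ncard = Fintype.card ι := by
  have hinj : Function.Injective fun i => PointedCone.hull ℝ {r i} := fun i j hij =>
    Set.singleton_injective (h.injOn_hull (hr i) (hr j) (by simpa only [Set.image_singleton]))
  rw [h.rays_spannedCones hr, ← Set.image_univ, Set.ncard_image_of_injective _ hinj,
    Set.ncard_univ, Nat.card_eq_fintype_card]

theorem ncard_maximalCones_spannedCones (h : IsConicCoordinates r Δ c) :
    (maximalCones (spannedCones ℝ r Δ)).ncard = {S | Maximal (· ∈ Δ) S}.ncard := by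
  rw [maximalCones, spannedCones,
    ← image_monotone_setOfPred_maximal_mem fun _ _ hS hT => h.hull_le_hull_iff hS hT]
  exact (h.injOn_hull.mono fun S hS => hS.1).ncard_image

end IsConicCoordinates

section MinWeight

variable {σ R M : Type*} [CommSemiring R] [AddCommMonoid M] [LinearOrder M]

/-- `s` is the least weight of a monomial of `p`, when the variable `X i` has weight `w i`. -/
def IsMinWeight (w : σ → M) (p : MvPolynomial σ R) (s : M) : Prop :=
  IsLeast (Finsupp.weight w '' (p.support : Set (σ →₀ ℕ))) s

namespace IsMinWeight

variable {w : σ → M} {p q : MvPolynomial σ R} {s t : M}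

theorem le_weight (hp : IsMinWeight w p s) {m : σ →₀ ℕ} (hm : p.coeff m ≠ 0) :
    s ≤ Finsupp.weight w m :=
  hp.2 ⟨m, MvPolynomial.mem_support_iff.2 hm, rfl⟩

theorem one [Nontrivial R] : IsMinWeight w (1 : MvPolynomial σ R) 0 := by
  simp [IsMinWeight, MvPolynomial.support_one]

theorem X [Nontrivial R] (i : σ) : IsMinWeight w (MvPolynomial.X i : MvPolynomial σ R) (w i) := by
  simp [IsMinWeight, MvPolynomial.support_X, Finsupp.weight_single]

theorem add_of_disjoint (hpq : Disjoint p.support q.support) (hp : IsMinWeight w p s)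
    (hq : IsMinWeight w q t) : IsMinWeight w (p + q) (min s t) := by
  classical
  have hsupp : (p + q).support = p.support ∪ q.support := Finsupp.support_add_eq hpq
  rw [IsMinWeight, hsupp, Finset.coe_union, Set.image_union]
  exact hp.union hq

theorem weightedHomogeneousComponent_ne_zero (hp : IsMinWeight w p s) :
    MvPolynomial.weightedHomogeneousComponent w s p ≠ 0 := by
  classical
  obtain ⟨⟨m, hm, rfl⟩, -⟩ := hp
  refine MvPolynomial.ne_zero_iff.2 ⟨m, ?_⟩
  rw [MvPolynomial.coeff_weightedHomogeneousComponent, if_pos rfl]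
  exact MvPolynomial.mem_support_iff.1 hm

variable [IsOrderedCancelAddMonoid M]

theorem coeff_mul_eq (hp : IsMinWeight w p s) (hq : IsMinWeight w q t) {k : σ →₀ ℕ}
    (hk : Finsupp.weight w k = s + t) :
    (p * q).coeff k = (MvPolynomial.weightedHomogeneousComponent w s p *
      MvPolynomial.weightedHomogeneousComponent w t q).coeff k := by
  classical
  rw [MvPolynomial.coeff_mul, MvPolynomial.coeff_mul]
  refine Finset.sum_congr rfl fun ⟨a, b⟩ hab => ?_
  obtain rfl : a + b = k := Finset.HasAntidiagonal.mem_antidiagonal.1 hab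
  by_cases hpa : p.coeff a = 0
  · simp [MvPolynomial.coeff_weightedHomogeneousComponent, hpa]
  by_cases hqb : q.coeff b = 0
  · simp [MvPolynomial.coeff_weightedHomogeneousComponent, hqb]
  rw [map_add, eq_comm, add_eq_add_iff_eq_and_eq (hp.le_weight hpa) (hq.le_weight hqb)] at hk
  simp only [MvPolynomial.coeff_weightedHomogeneousComponent, if_pos hk.1.symm, if_pos hk.2.symm]

theorem mul [NoZeroDivisors R] (hp : IsMinWeight w p s) (hq : IsMinWeight w q t) :
    IsMinWeight w (p * q) (s + t) := by
  classical
  constructor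
  · obtain ⟨k, hk⟩ := MvPolynomial.ne_zero_iff.1 (mul_ne_zero
      hp.weightedHomogeneousComponent_ne_zero hq.weightedHomogeneousComponent_ne_zero)
    have hweight : Finsupp.weight w k = s + t :=
      ((MvPolynomial.weightedHomogeneousComponent_isWeightedHomogeneous s p).mul
        (MvPolynomial.weightedHomogeneousComponent_isWeightedHomogeneous t q)) hk
    rw [← hp.coeff_mul_eq hq hweight] at hk
    exact ⟨k, MvPolynomial.mem_support_iff.2 hk, hweight⟩
  · rintro _ ⟨k, hk, rfl⟩
    obtain ⟨a, ha, b, hb, rfl⟩ := Finset.mem_add.1 (MvPolynomial.support_mul p q hk)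
    rw [map_add]
    exact add_le_add (hp.2 ⟨a, ha, rfl⟩) (hq.2 ⟨b, hb, rfl⟩)

theorem prod [Nontrivial R] [NoZeroDivisors R] {ι : Type*} {S : Finset ι}
    {f : ι → MvPolynomial σ R} {g : ι → M} (h : ∀ i ∈ S, IsMinWeight w (f i) (g i)) :
    IsMinWeight w (∏ i ∈ S, f i) (∑ i ∈ S, g i) := by
  induction S using Finset.cons_induction with
  | empty => exact one
  | cons i S hi ih =>
    rw [Finset.prod_cons, Finset.sum_cons]
    rw [Finset.forall_mem_cons] at h
    exact h.1.mul (ih h.2)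

end IsMinWeight

end MinWeight

section NormalFan

variable {d : ℕ} {V P : Set (Fin d → ℝ)} {v w x : Fin d → ℝ} {s t : ℝ}

theorem le_dotProduct_of_mem_convexHull (hs : IsLeast ((v ⬝ᵥ ·) '' V) s)
    (hx : x ∈ convexHull ℝ V) : s ≤ v ⬝ᵥ x := by
  have hconv : Convex ℝ {x : Fin d → ℝ | s ≤ v ⬝ᵥ x} :=
    convex_halfSpace_ge ⟨dotProduct_add v, fun a x => dotProduct_smul a v x⟩ s
  exact convexHull_min (fun y hy => hs.2 ⟨y, hy, rfl⟩) hconv hx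

theorem mem_minFace_convexHull_iff (hs : IsLeast ((v ⬝ᵥ ·) '' V) s) :
    x ∈ minFace (convexHull ℝ V) v ↔ x ∈ convexHull ℝ V ∧ v ⬝ᵥ x = s := by
  refine and_congr_right fun hx => ⟨fun hmin => ?_, fun hxs y hy => ?_⟩
  · obtain ⟨y, hy, rfl⟩ := hs.1
    exact (hmin y (subset_convexHull ℝ V hy)).antisymm (le_dotProduct_of_mem_convexHull hs hx)
  · rw [hxs]
    exact le_dotProduct_of_mem_convexHull hs hy

theorem minFace_convexHull_nonempty (hs : IsLeast ((v ⬝ᵥ ·) '' V) s) :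
    (minFace (convexHull ℝ V) v).Nonempty := by
  obtain ⟨x, hx, hxs⟩ := hs.1
  exact ⟨x, (mem_minFace_convexHull_iff hs).2 ⟨subset_convexHull ℝ V hx, hxs⟩⟩

theorem isLeast_smul_dotProduct {a : ℝ} (ha : 0 ≤ a) (hs : IsLeast ((v ⬝ᵥ ·) '' V) s) :
    IsLeast ((a • v ⬝ᵥ ·) '' V) (a * s) := by
  simpa only [Set.image_image, smul_dotProduct, smul_eq_mul] using
    (monotone_mul_left_of_nonneg ha).map_isLeast hs

theorem mem_innerNormalCone_minFace_iff :
    v ∈ innerNormalCone P (minFace P w) ↔ minFace P w ⊆ minFace P v :=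
  ⟨fun h x hx => ⟨hx.1, h x hx⟩, fun h _ hx => (h hx).2⟩

theorem exists_pos_forall_mul_le {𝕜 ι : Type*} [Field 𝕜] [LinearOrder 𝕜] [IsStrictOrderedRing 𝕜]
    [Finite ι] {a b : ι → 𝕜} (hb : 0 ≤ b) (hab : ∀ i, b i = 0 → a i ≤ 0) :
    ∃ ε > 0, ∀ i, ε * a i ≤ b i := by
  obtain ⟨K, hK⟩ := Set.finite_range (fun i => a i / b i) |>.bddAbove
  have hKpos : 0 < max K 1 := lt_max_of_lt_right one_pos
  refine ⟨(max K 1)⁻¹, inv_pos.2 hKpos, fun i => ?_⟩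
  rcases (hb i).eq_or_lt with hbi | hbi
  · rw [← hbi]
    exact mul_nonpos_of_nonneg_of_nonpos (inv_pos.2 hKpos).le (hab i hbi.symm)
  · rw [inv_mul_le_iff₀ hKpos, ← div_le_iff₀ hbi]
    exact (hK ⟨i, rfl⟩).trans (le_max_left K 1)

theorem minFace_convexHull_subset_iff (hV : V.Finite) (hs : IsLeast ((v ⬝ᵥ ·) '' V) s)
    (ht : IsLeast ((w ⬝ᵥ ·) '' V) t) :
    minFace (convexHull ℝ V) w ⊆ minFace (convexHull ℝ V) v ↔
      ∃ ε > 0, IsLeast (((w - ε • v) ⬝ᵥ ·) '' V) (t - ε * s) := by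
  constructor
  · intro hsub
    have heq : ∀ x ∈ V, w ⬝ᵥ x = t → v ⬝ᵥ x = s := fun x hx hxt =>
      ((mem_minFace_convexHull_iff hs).1 (hsub ((mem_minFace_convexHull_iff ht).2
        ⟨subset_convexHull ℝ V hx, hxt⟩))).2
    have := hV.to_subtype
    obtain ⟨ε, hε, hle⟩ := exists_pos_forall_mul_le (ι := V)
      (a := fun x => v ⬝ᵥ (x : Fin d → ℝ) - s) (b := fun x => w ⬝ᵥ (x : Fin d → ℝ) - t)
      (fun x => sub_nonneg.2 (ht.2 ⟨x, x.2, rfl⟩))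
      fun x hx => (sub_eq_zero.2 (heq x x.2 (sub_eq_zero.1 hx))).le
    refine ⟨ε, hε, ?_, ?_⟩
    · obtain ⟨x, hx, hxt⟩ := ht.1
      refine ⟨x, hx, ?_⟩
      simp only [sub_dotProduct, smul_dotProduct, smul_eq_mul, heq x hx hxt]
      exact congrArg (· - ε * s) hxt
    · rintro _ ⟨x, hx, rfl⟩
      simp only [sub_dotProduct, smul_dotProduct, smul_eq_mul]
      linarith [hle ⟨x, hx⟩]
  · rintro ⟨ε, hε, hsub⟩ x hx
    rw [mem_minFace_convexHull_iff ht] at hx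
    rw [mem_minFace_convexHull_iff hs]
    refine ⟨hx.1, le_antisymm (le_of_mul_le_mul_left ?_ hε)
      (le_dotProduct_of_mem_convexHull hs hx.1)⟩
    have hle := le_dotProduct_of_mem_convexHull hsub hx.1
    rw [sub_dotProduct, smul_dotProduct, smul_eq_mul, hx.2] at hle
    linarith

theorem IsConicCoordinates.support_subset_iff {𝕜 ι E : Type*} [Field 𝕜] [LinearOrder 𝕜]
    [IsStrictOrderedRing 𝕜] [Fintype ι] [AddCommGroup E] [Module 𝕜 E] {r : ι → E}
    {Δ : Set (Set ι)} {c : E → ι → 𝕜} (hc : IsConicCoordinates r Δ c) {v w : E} :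
    Function.support (c v) ⊆ Function.support (c w) ↔
      ∃ ε > (0 : 𝕜), c (w - ε • v) = c w - ε • c v := by
  constructor
  · intro hsub
    have hzero : ∀ i, c w i = 0 → c v i = 0 := fun i hwi =>
      by_contra fun hvi => hsub hvi hwi
    obtain ⟨ε, hε, hle⟩ := exists_pos_forall_mul_le (hc.nonneg w) fun i hi => (hzero i hi).le
    refine ⟨ε, hε, ?_⟩
    have hcoord := hc.eq_of_support_subset _ (hc.support_mem w) (c w - ε • c v)
      (fun i => sub_nonneg.2 (hle i)) fun i hi hwi => hi (by simp [hwi, hzero i hwi])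
    simpa [sub_smul, mul_smul, ← Finset.smul_sum, hc.sum_smul] using hcoord
  · rintro ⟨ε, hε, he⟩ i hi hwi
    have hnonneg := hc.nonneg (w - ε • v) i
    rw [he, Pi.sub_apply, hwi, zero_sub, Pi.smul_apply, smul_eq_mul, Pi.zero_apply,
      Left.nonneg_neg_iff] at hnonneg
    exact (mul_pos hε ((hc.nonneg v i).lt_of_ne' hi)).not_ge hnonneg

theorem innerNormalFan_convexHull_eq_spannedCones {ι : Type*} [Fintype ι] {r : ι → Fin d → ℝ}
    {Δ : Set (Set ι)} {c : (Fin d → ℝ) → ι → ℝ} (hc : IsConicCoordinates r Δ c) (hV : V.Finite)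
    {h : (Fin d → ℝ) → ℝ} (hh : ∀ v, IsLeast ((v ⬝ᵥ ·) '' V) (h v))
    (hadd : ∀ v w, h (v + w) = h v + h w ↔ c (v + w) = c v + c w) :
    innerNormalFan (convexHull ℝ V) = spannedCones ℝ r Δ := by
  classical
  have hcone : ∀ w, innerNormalCone (convexHull ℝ V) (minFace (convexHull ℝ V) w) =
      PointedCone.hull ℝ (r '' Function.support (c w)) := fun w => by
    ext v
    simp only [mem_innerNormalCone_minFace_iff, hc.mem_hull_iff (hc.support_mem w),
      hc.support_subset_iff, minFace_convexHull_subset_iff hV (hh v) (hh w)]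
    refine exists_congr fun ε => and_congr_right fun hε => ?_
    have hε : 0 ≤ ε := le_of_lt hε
    have hsmul : h (ε • v) = ε * h v := (hh _).unique (isLeast_smul_dotProduct hε (hh v))
    have hdecomp := hadd (ε • v) (w - ε • v)
    rwa [add_sub_cancel, hsmul, hc.coord_smul hε, ← sub_eq_iff_eq_add', ← sub_eq_iff_eq_add',
      eq_comm, eq_comm (a := c w - _), ← (hh _).isLeast_iff_eq] at hdecomp
  ext C
  constructor
  · rintro ⟨w, -, rfl⟩
    exact ⟨_, hc.support_mem w, (hcone w).symm⟩
  · rintro ⟨S, hS, rfl⟩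
    have hsupp : Function.support (S.indicator (1 : ι → ℝ)) = S := by
      ext i
      simp
    refine ⟨∑ i, S.indicator (1 : ι → ℝ) i • r i, minFace_convexHull_nonempty (hh _), ?_⟩
    rw [hcone, hc.eq_of_support_subset S hS (S.indicator 1)
      (Set.indicator_nonneg fun _ _ => zero_le_one) hsupp.subset, hsupp]

end NormalFan

section SignCoherence

theorem posPart_sub_of_inf_eq_zero {G : Type*} [AddCommGroup G] [Lattice G] [AddLeftMono G]
    {p q : G} (h : p ⊓ q = 0) : (p - q)⁺ = p := by
  rwa [inf_eq_sub_posPart_sub, sub_eq_zero, eq_comm] at h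

theorem posPart_add_iff_negPart_add {G : Type*} [AddCommGroup G] [Lattice G] [AddLeftMono G]
    (v w : G) : (v + w)⁺ = v⁺ + w⁺ ↔ (v + w)⁻ = v⁻ + w⁻ := by
  have h : v⁺ + w⁺ - (v + w)⁺ = v⁻ + w⁻ - (v + w)⁻ := by
    rw [sub_eq_sub_iff_sub_eq_sub, add_sub_add_comm]
    simp only [posPart_sub_negPart]
  rw [eq_comm, ← sub_eq_zero, h, sub_eq_zero, eq_comm]

variable {𝕜 ι κ : Type*}

/-- Some vector `r i` with `i ∈ S` is positive in coordinate `k`. Negativity is expressed by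
applying this to `-r`. -/
def PosAt [Zero 𝕜] [LT 𝕜] (r : ι → κ → 𝕜) (S : Set ι) (k : κ) : Prop := ∃ i ∈ S, 0 < r i k

theorem PosAt.mono [Zero 𝕜] [LT 𝕜] {r : ι → κ → 𝕜} {S T : Set ι} {k : κ} (h : PosAt r S k)
    (hST : S ⊆ T) : PosAt r T k :=
  h.imp fun _ hi => ⟨hST hi.1, hi.2⟩

variable [Ring 𝕜] [LinearOrder 𝕜] [Fintype ι]

/-- The combination of the positive parts of the vectors `r i` with coefficients `a i`. It is the
positive part of `∑ i, a i • r i` if `a` is non-negative and no two of the vectors that occur have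
opposite signs in a coordinate. -/
def posSum (r : ι → κ → 𝕜) (a : ι → 𝕜) : κ → 𝕜 := ∑ i, a i • (r i)⁺

theorem posSum_apply (r : ι → κ → 𝕜) (a : ι → 𝕜) (k : κ) :
    posSum r a k = ∑ i, a i * (r i k)⁺ := by
  simp only [posSum, Finset.sum_apply, Pi.smul_apply, smul_eq_mul]
  rfl

theorem posSum_add (r : ι → κ → 𝕜) (a b : ι → 𝕜) :
    posSum r (a + b) = posSum r a + posSum r b := by
  simp only [posSum, Pi.add_apply, add_smul, Finset.sum_add_distrib]

variable [IsStrictOrderedRing 𝕜]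

theorem posSum_sub_posSum_neg (r : ι → κ → 𝕜) (a : ι → 𝕜) :
    posSum r a - posSum (-r) a = ∑ i, a i • r i := by
  simp only [posSum, Pi.neg_apply, posPart_neg, ← Finset.sum_sub_distrib, ← smul_sub,
    posPart_sub_negPart]

variable {r : ι → κ → 𝕜} {a : ι → 𝕜}

theorem posSum_nonneg (ha : 0 ≤ a) : 0 ≤ posSum r a :=
  Finset.sum_nonneg fun i _ => smul_nonneg (ha i) (posPart_nonneg (r i))

theorem posSum_pos_iff (ha : 0 ≤ a) {k : κ} :
    0 < posSum r a k ↔ PosAt r (Function.support a) k := by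
  have hterm : ∀ i ∈ Finset.univ, 0 ≤ a i * (r i k)⁺ := fun i _ =>
    mul_nonneg (ha i) (posPart_nonneg _)
  rw [posSum_apply, (Finset.sum_nonneg hterm).lt_iff_ne', Ne,
    Finset.sum_eq_zero_iff_of_nonneg hterm]
  simp [PosAt, not_or]

theorem posPart_sum_smul (ha : 0 ≤ a)
    (hr : ∀ k, ¬(PosAt r (Function.support a) k ∧ PosAt (-r) (Function.support a) k)) :
    (∑ i, a i • r i)⁺ = posSum r a := by
  rw [← posSum_sub_posSum_neg]
  refine posPart_sub_of_inf_eq_zero (funext fun k => le_antisymm (not_lt.1 fun hk => hr k ?_)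
    (le_inf (posSum_nonneg ha k) (posSum_nonneg ha k)))
  rw [← posSum_pos_iff ha, ← posSum_pos_iff ha]
  exact lt_inf_iff.1 hk

theorem negPart_sum_smul (ha : 0 ≤ a)
    (hr : ∀ k, ¬(PosAt r (Function.support a) k ∧ PosAt (-r) (Function.support a) k)) :
    (∑ i, a i • r i)⁻ = posSum (-r) a := by
  rw [← posPart_neg, ← Finset.sum_neg_distrib]
  simp only [← smul_neg]
  refine posPart_sum_smul (r := -r) ha fun k => ?_
  rw [neg_neg, and_comm]
  exact hr k

end SignCoherence

section Extend

variable {α β M : Type*} {g : α → β} {f : α → M}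

theorem extend_le [Zero M] [Preorder M] (hg : Function.Injective g) {h : β → M} (hf : f ≤ h ∘ g)
    (h0 : 0 ≤ h) : Function.extend g f 0 ≤ h := by
  intro b
  by_cases hb : ∃ a, g a = b
  · obtain ⟨a, rfl⟩ := hb
    rw [hg.extend_apply]
    exact hf a
  · rw [Function.extend_apply' _ _ _ hb]
    exact h0 b

theorem sum_smul_single_one [Fintype α] [DecidableEq β] [NonAssocSemiring M]
    (hg : Function.Injective g) :
    ∑ a, f a • (Pi.single (g a) 1 : β → M) = Function.extend g f 0 := by
  ext b
  simp only [Finset.sum_apply, Pi.smul_apply, smul_eq_mul]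
  by_cases hb : ∃ a, g a = b
  · obtain ⟨a, rfl⟩ := hb
    rw [hg.extend_apply, Finset.sum_eq_single a (fun c _ hc => by simp [hg.ne hc.symm]) (by simp)]
    simp
  · rw [Function.extend_apply' _ _ _ hb]
    exact Finset.sum_eq_zero fun a _ => by
      rw [Pi.single_eq_of_ne fun h => hb ⟨a, h.symm⟩, mul_zero]

end Extend

/-- The index set of the rays: `e_i`, `-e_i` and `e_j - e_{j+1}`. -/
abbrev RayIndex (n : ℕ) : Type := Fin (n + 1) ⊕ Fin (n + 1) ⊕ Fin n

variable {n : ℕ}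

/-- The index of the ray spanned by `e_i`. -/
abbrev posIndex (i : Fin (n + 1)) : RayIndex n := Sum.inl i

/-- The index of the ray spanned by `-e_i`. -/
abbrev negIndex (i : Fin (n + 1)) : RayIndex n := Sum.inr (Sum.inl i)

/-- The index of the ray spanned by `e_j - e_{j+1}`. -/
abbrev descIndex (j : Fin n) : RayIndex n := Sum.inr (Sum.inr j)

/-- The primitive generators of the rays. -/
def rayVector (n : ℕ) : RayIndex n → Fin (n + 1) → ℝ :=
  Sum.elim (fun i => Pi.single i 1)
    (Sum.elim (fun i => -Pi.single i 1) fun j => Pi.single j.castSucc 1 - Pi.single j.succ 1)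

theorem rayVectors_succ (n : ℕ) : rayVectors (n + 1) = Set.range (rayVector n) := by
  rw [rayVector, Set.Sum.elim_range, Set.Sum.elim_range, ← Set.union_assoc]
  rfl

theorem posPart_single_one_sub_single_one {κ R : Type*} [DecidableEq κ] [Ring R] [LinearOrder R]
    [IsOrderedRing R] {i k : κ} (hik : i ≠ k) :
    (Pi.single i 1 - Pi.single k 1 : κ → R)⁺ = Pi.single i 1 := by
  refine posPart_sub_of_inf_eq_zero (funext fun l => ?_)
  rw [Pi.inf_apply, Pi.single_apply, Pi.single_apply]
  split_ifs with hi hk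
  · exact absurd (hi.symm.trans hk) hik
  all_goals simp

theorem posPart_rayVector (n : ℕ) (i : RayIndex n) :
    (rayVector n i)⁺ = Sum.elim (fun i => Pi.single i 1)
      (Sum.elim (fun _ => 0) fun j => Pi.single j.castSucc 1) i := by
  have hsingle : ∀ k : Fin (n + 1), (0 : Fin (n + 1) → ℝ) ≤ Pi.single k 1 := fun k =>
    Pi.single_nonneg.2 zero_le_one
  rcases i with k | k | j
  · exact posPart_eq_self.2 (hsingle k)
  · exact posPart_eq_zero.2 (neg_nonpos.2 (hsingle k))
  · exact posPart_single_one_sub_single_one Fin.castSucc_lt_succ.ne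

theorem posPart_neg_rayVector (n : ℕ) (i : RayIndex n) :
    ((-rayVector n) i)⁺ = Sum.elim (fun _ => 0)
      (Sum.elim (fun i => Pi.single i 1) fun j => Pi.single j.succ 1) i := by
  have hsingle : ∀ k : Fin (n + 1), (0 : Fin (n + 1) → ℝ) ≤ Pi.single k 1 := fun k =>
    Pi.single_nonneg.2 zero_le_one
  rcases i with k | k | j
  · exact posPart_eq_zero.2 (neg_nonpos.2 (hsingle k))
  · exact (congrArg _ (neg_neg _)).trans (posPart_eq_self.2 (hsingle k))
  · exact (congrArg (·⁺) (neg_sub _ _)).trans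
      (posPart_single_one_sub_single_one Fin.castSucc_lt_succ.ne')

theorem posSum_rayVector (a : RayIndex n → ℝ) :
    posSum (rayVector n) a =
      a ∘ posIndex + Function.extend Fin.castSucc (a ∘ descIndex) 0 := by
  rw [← sum_smul_single_one (Fin.castSucc_injective n), pi_eq_sum_univ' (a ∘ posIndex)]
  simp [posSum, posPart_rayVector]

theorem posSum_neg_rayVector (a : RayIndex n → ℝ) :
    posSum (-rayVector n) a = a ∘ negIndex + Function.extend Fin.succ (a ∘ descIndex) 0 := by
  rw [← sum_smul_single_one (Fin.succ_injective n), pi_eq_sum_univ' (a ∘ negIndex)]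
  simp [posSum, posPart_neg_rayVector, -Pi.neg_apply]

theorem single_one_apply_pos_iff {κ R : Type*} [DecidableEq κ] [Zero R] [One R] [PartialOrder R]
    [ZeroLEOneClass R] [NeZero (1 : R)] {i k : κ} : 0 < (Pi.single i 1 : κ → R) k ↔ i = k := by
  rw [Pi.single_apply, eq_comm (a := i)]
  split_ifs with h <;> simp [h]

theorem posAt_rayVector_iff {S : Set (RayIndex n)} {k : Fin (n + 1)} :
    PosAt (rayVector n) S k ↔
      posIndex k ∈ S ∨ ∃ j : Fin n, j.castSucc = k ∧ descIndex j ∈ S := by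
  have hpos : ∀ i, 0 < rayVector n i k ↔ 0 < (rayVector n i)⁺ k := fun i => posPart_pos_iff.symm
  simp only [PosAt, hpos, posPart_rayVector]
  simp [single_one_apply_pos_iff, and_comm]

theorem posAt_neg_rayVector_iff {S : Set (RayIndex n)} {k : Fin (n + 1)} :
    PosAt (-rayVector n) S k ↔
      negIndex k ∈ S ∨ ∃ j : Fin n, j.succ = k ∧ descIndex j ∈ S := by
  have hpos : ∀ i, 0 < (-rayVector n) i k ↔ 0 < ((-rayVector n) i)⁺ k := fun i =>
    posPart_pos_iff.symm
  simp only [PosAt, hpos, posPart_neg_rayVector]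
  simp [single_one_apply_pos_iff, and_comm]

theorem eq_of_posSum_eq {a b : RayIndex n → ℝ}
    (hpos : posSum (rayVector n) a = posSum (rayVector n) b)
    (hneg : posSum (-rayVector n) a = posSum (-rayVector n) b)
    (hdesc : a ∘ descIndex = b ∘ descIndex) : a = b := by
  rw [posSum_rayVector, posSum_rayVector, hdesc, add_left_inj] at hpos
  rw [posSum_neg_rayVector, posSum_neg_rayVector, hdesc, add_left_inj] at hneg
  ext (i | i | j)
  · exact congrFun hpos i
  · exact congrFun hneg i
  · exact congrFun hdesc j

/-- The sets of rays that span a cone of the fan: the generators do not have opposite signs in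
any coordinate, and `e_j` and `-e_{j+1}` do not both occur. -/
def compatibleSets (n : ℕ) : Set (Set (RayIndex n)) :=
  {S | (∀ k, ¬(PosAt (rayVector n) S k ∧ PosAt (-rayVector n) S k)) ∧
    ∀ j : Fin n, ¬(posIndex j.castSucc ∈ S ∧ negIndex j.succ ∈ S)}

theorem isLowerSet_compatibleSets (n : ℕ) : IsLowerSet (compatibleSets n) := fun _ _ hTS hS =>
  ⟨fun k hk => hS.1 k ⟨hk.1.mono hTS, hk.2.mono hTS⟩, fun j hj => hS.2 j ⟨hTS hj.1, hTS hj.2⟩⟩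

theorem singleton_mem_compatibleSets (i : RayIndex n) : {i} ∈ compatibleSets n := by
  refine ⟨fun k => ?_, fun j hj => ?_⟩
  · rintro ⟨⟨_, rfl, hpos⟩, ⟨_, rfl, hneg⟩⟩
    exact hpos.not_gt (neg_pos.1 hneg)
  · exact absurd (hj.1.trans hj.2.symm) Sum.inl_ne_inr

/-- The coefficient of `e_j - e_{j+1}` in `v`. -/
noncomputable def descCoeff (v : Fin (n + 1) → ℝ) (j : Fin n) : ℝ :=
  min (v j.castSucc)⁺ (v j.succ)⁻

/-- The coefficients of `v` with respect to the rays of the cone that contains it: after the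
vectors `e_j - e_{j+1}` have been used up, the rest of `v` is a combination of the `e_i` and
`-e_i`. -/
noncomputable def rayCoeff (v : Fin (n + 1) → ℝ) : RayIndex n → ℝ :=
  Sum.elim (v⁺ - Function.extend Fin.castSucc (descCoeff v) 0)
    (Sum.elim (v⁻ - Function.extend Fin.succ (descCoeff v) 0) (descCoeff v))

theorem rayCoeff_comp_descIndex (v : Fin (n + 1) → ℝ) : rayCoeff v ∘ descIndex = descCoeff v :=
  rfl

theorem posSum_rayCoeff (v : Fin (n + 1) → ℝ) : posSum (rayVector n) (rayCoeff v) = v⁺ := by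
  rw [posSum_rayVector]
  exact sub_add_cancel _ _

theorem posSum_neg_rayCoeff (v : Fin (n + 1) → ℝ) : posSum (-rayVector n) (rayCoeff v) = v⁻ := by
  rw [posSum_neg_rayVector]
  exact sub_add_cancel _ _

theorem sum_rayCoeff_smul (v : Fin (n + 1) → ℝ) : ∑ i, rayCoeff v i • rayVector n i = v := by
  rw [← posSum_sub_posSum_neg, posSum_rayCoeff, posSum_neg_rayCoeff, posPart_sub_negPart]

theorem rayCoeff_nonneg (v : Fin (n + 1) → ℝ) : 0 ≤ rayCoeff v := by
  rintro (i | i | j)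
  · exact sub_nonneg.2 (extend_le (Fin.castSucc_injective n) (fun j => min_le_left _ _)
      (posPart_nonneg v) i)
  · exact sub_nonneg.2 (extend_le (Fin.succ_injective n) (fun j => min_le_right _ _)
      (negPart_nonneg v) i)
  · exact le_min (posPart_nonneg _) (negPart_nonneg _)

theorem support_rayCoeff_mem (v : Fin (n + 1) → ℝ) :
    Function.support (rayCoeff v) ∈ compatibleSets n := by
  refine ⟨fun k => ?_, fun j ⟨hpos, hneg⟩ => ?_⟩
  · rw [← posSum_pos_iff (rayCoeff_nonneg v), ← posSum_pos_iff (rayCoeff_nonneg v),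
      posSum_rayCoeff, posSum_neg_rayCoeff]
    rintro ⟨hpos, hneg⟩
    exact (posPart_pos_iff.1 hpos).not_gt (negPart_pos_iff.1 hneg)
  · rw [Function.mem_support, rayCoeff, Sum.elim_inl, Pi.sub_apply,
      (Fin.castSucc_injective n).extend_apply] at hpos
    rw [Function.mem_support, rayCoeff, Sum.elim_inr, Sum.elim_inl, Pi.sub_apply,
      (Fin.succ_injective n).extend_apply] at hneg
    rcases min_choice (v j.castSucc)⁺ (v j.succ)⁻ with h | h
    · exact hpos (sub_eq_zero.2 h.symm)
    · exact hneg (sub_eq_zero.2 h.symm)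

theorem rayCoeff_sum_smul {S : Set (RayIndex n)} (hS : S ∈ compatibleSets n)
    {a : RayIndex n → ℝ} (ha : 0 ≤ a) (haS : Function.support a ⊆ S) :
    rayCoeff (∑ i, a i • rayVector n i) = a := by
  obtain ⟨hcoherent, hdisjoint⟩ := isLowerSet_compatibleSets n haS hS
  have hpos := posPart_sum_smul ha hcoherent
  have hneg := negPart_sum_smul ha hcoherent
  refine eq_of_posSum_eq ((posSum_rayCoeff _).trans hpos) ((posSum_neg_rayCoeff _).trans hneg)
    (funext fun j => ?_)
  have hposj := (congrFun hpos j.castSucc).trans (congrFun (posSum_rayVector a) j.castSucc)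
  have hnegj := (congrFun hneg j.succ).trans (congrFun (posSum_neg_rayVector a) j.succ)
  rw [Pi.posPart_apply, Pi.add_apply, (Fin.castSucc_injective n).extend_apply] at hposj
  rw [Pi.negPart_apply, Pi.add_apply, (Fin.succ_injective n).extend_apply] at hnegj
  have hmin : min (a (posIndex j.castSucc)) (a (negIndex j.succ)) = 0 := by
    rcases not_and_or.1 (hdisjoint j) with h | h
    · rw [Function.notMem_support.1 h]
      exact min_eq_left (ha _)
    · rw [Function.notMem_support.1 h]
      exact min_eq_right (ha _)
  rw [rayCoeff_comp_descIndex, descCoeff, hposj, hnegj]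
  simp only [Function.comp_apply]
  rw [min_add_add_right, hmin, zero_add]

theorem isConicCoordinates_rayVector (n : ℕ) :
    IsConicCoordinates (rayVector n) (compatibleSets n) rayCoeff where
  isLowerSet := isLowerSet_compatibleSets n
  nonneg := rayCoeff_nonneg
  support_mem := support_rayCoeff_mem
  sum_smul := sum_rayCoeff_smul
  eq_of_support_subset _ hS _ ha haS := rayCoeff_sum_smul hS ha haS

theorem rayCoeff_add_iff (v w : Fin (n + 1) → ℝ) :
    rayCoeff (v + w) = rayCoeff v + rayCoeff w ↔
      (v + w)⁻ = v⁻ + w⁻ ∧ descCoeff (v + w) = descCoeff v + descCoeff w := by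
  constructor
  · intro h
    refine ⟨?_, congrArg (· ∘ descIndex) h⟩
    have hneg := congrArg (posSum (-rayVector n)) h
    rwa [posSum_add, posSum_neg_rayCoeff, posSum_neg_rayCoeff, posSum_neg_rayCoeff] at hneg
  · rintro ⟨hneg, hdesc⟩
    refine eq_of_posSum_eq ?_ ?_ hdesc
    · rw [posSum_add, posSum_rayCoeff, posSum_rayCoeff, posSum_rayCoeff,
        posPart_add_iff_negPart_add, hneg]
    · rw [posSum_add, posSum_neg_rayCoeff, posSum_neg_rayCoeff, posSum_neg_rayCoeff, hneg]

/-- The least value of `⟨v, ·⟩` on the pellytope: each factor of the polynomial contributes its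
least weight. -/
noncomputable def pellySupport (v : Fin (n + 1) → ℝ) : ℝ :=
  ∑ i, min 0 (v i) + ∑ j : Fin n, min (min 0 (v j.castSucc)) (v j.castSucc + v j.succ)

theorem pellyPolynomial_succ (n : ℕ) : pellyPolynomial (n + 1) =
    (∏ i : Fin (n + 1), (1 + MvPolynomial.X i)) * ∏ j : Fin n,
      (1 + MvPolynomial.X j.castSucc + MvPolynomial.X j.castSucc * MvPolynomial.X j.succ) :=
  rfl

theorem isMinWeight_one_add_X {σ R M : Type*} [CommSemiring R] [Nontrivial R] [AddCommMonoid M]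
    [LinearOrder M] (w : σ → M) (i : σ) :
    IsMinWeight w (1 + MvPolynomial.X i : MvPolynomial σ R) (min 0 (w i)) := by
  refine .add_of_disjoint ?_ .one (.X i)
  rw [MvPolynomial.support_one, MvPolynomial.support_X, Finset.disjoint_singleton]
  exact (Finsupp.single_ne_zero.2 one_ne_zero).symm

theorem isMinWeight_one_add_X_add_X_mul_X {σ R M : Type*} [CommSemiring R] [Nontrivial R]
    [NoZeroDivisors R] [AddCommMonoid M] [LinearOrder M] [IsOrderedCancelAddMonoid M]
    (w : σ → M) (i k : σ) :
    IsMinWeight w (1 + MvPolynomial.X i + MvPolynomial.X i * MvPolynomial.X k : MvPolynomial σ R)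
      (min (min 0 (w i)) (w i + w k)) := by
  classical
  refine .add_of_disjoint ?_ (isMinWeight_one_add_X w i) ((IsMinWeight.X i).mul (.X k))
  refine Finset.disjoint_of_subset_left MvPolynomial.support_add ?_
  simp [MvPolynomial.support_one, MvPolynomial.support_X, MvPolynomial.support_mul_X]

theorem isMinWeight_pellyPolynomial (v : Fin (n + 1) → ℝ) :
    IsMinWeight v (pellyPolynomial (n + 1)) (pellySupport v) := by
  rw [pellyPolynomial_succ]
  exact .mul (.prod fun i _ => isMinWeight_one_add_X v i)
    (.prod fun j _ => isMinWeight_one_add_X_add_X_mul_X v j.castSucc j.succ)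

theorem dotProduct_natCast_eq_weight {ι R : Type*} [Fintype ι] [CommSemiring R] (v : ι → R)
    (m : ι →₀ ℕ) : v ⬝ᵥ (fun i => (m i : R)) = Finsupp.weight v m := by
  rw [Finsupp.weight_apply, Finsupp.sum_fintype _ _ fun i => zero_nsmul (v i)]
  simp only [dotProduct, nsmul_eq_mul, mul_comm]

section NegPart

variable {G : Type*} [AddCommGroup G] [LinearOrder G] [IsOrderedAddMonoid G]

theorem min_zero_eq_neg_negPart (x : G) : min 0 x = -x⁻ := by
  rw [negPart_eq_neg_inf_zero, neg_neg, min_comm]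

theorem min_min_zero_add (x y : G) : min (min 0 x) (x + y) = min x⁺ y⁻ - x⁻ - y⁻ := by
  have hx : min 0 x = 0 - x⁻ := by rw [min_zero_eq_neg_negPart, zero_sub]
  have hxy : x + y = x⁺ + y - x⁻ := by rw [add_sub_right_comm, posPart_sub_negPart]
  have hy : min 0 (x⁺ + y) = min x⁺ y⁻ - y⁻ := by
    rcases le_total 0 y with h | h
    · rw [negPart_eq_zero.2 h, min_eq_left (add_nonneg (posPart_nonneg x) h),
        min_eq_right (posPart_nonneg x), sub_zero]
    · rw [negPart_eq_neg.2 h, ← min_sub_sub_right, sub_neg_eq_add, sub_self, min_comm]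
  rw [hx, hxy, min_sub_sub_right, hy, sub_right_comm]

end NegPart

theorem pellySupport_add_iff (v w : Fin (n + 1) → ℝ) :
    pellySupport (v + w) = pellySupport v + pellySupport w ↔
      (v + w)⁻ = v⁻ + w⁻ ∧ descCoeff (v + w) = descCoeff v + descCoeff w := by
  -- Every summand is superadditive, so the sum is additive only if each summand is.
  have hlin : ∀ i ∈ Finset.univ, min 0 (v i) + min 0 (w i) ≤ min 0 ((v + w) i) := fun i _ =>
    min_add_min_le_min_add_add.trans_eq (by rw [add_zero, Pi.add_apply])
  have hquad : ∀ j ∈ (Finset.univ : Finset (Fin n)),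
      min (min 0 (v j.castSucc)) (v j.castSucc + v j.succ) +
        min (min 0 (w j.castSucc)) (w j.castSucc + w j.succ) ≤
      min (min 0 ((v + w) j.castSucc)) ((v + w) j.castSucc + (v + w) j.succ) := fun j _ =>
    min_add_min_le_min_add_add.trans
      (min_le_min (hlin _ (Finset.mem_univ _)) (add_add_add_comm _ _ _ _).le)
  rw [pellySupport, pellySupport, pellySupport, add_add_add_comm, ← Finset.sum_add_distrib,
    ← Finset.sum_add_distrib, eq_comm, add_eq_add_iff_eq_and_eq (Finset.sum_le_sum hlin)
      (Finset.sum_le_sum hquad), Finset.sum_eq_sum_iff_of_le hlin,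
    Finset.sum_eq_sum_iff_of_le hquad]
  simp only [Finset.mem_univ, true_imp_iff, min_min_zero_add]
  simp only [min_zero_eq_neg_negPart, funext_iff]
  have hneg : (∀ i, -(v i)⁻ + -(w i)⁻ = -((v + w) i)⁻) ↔ ∀ i, ((v + w) i)⁻ = (v i)⁻ + (w i)⁻ :=
    forall_congr' fun i => by rw [← neg_add, neg_inj, eq_comm]
  rw [hneg]
  refine and_congr_right fun h => forall_congr' fun j => ?_
  simp only [Pi.add_apply, descCoeff] at h ⊢
  rw [h, h]
  constructor <;> intro <;> linarith

theorem innerNormalFan_pellytope (n : ℕ) :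
    innerNormalFan (pellytope (n + 1)) = spannedCones ℝ (rayVector n) (compatibleSets n) := by
  refine innerNormalFan_convexHull_eq_spannedCones (isConicCoordinates_rayVector n)
    ((Finset.finite_toSet _).image _) (h := pellySupport) (fun v => ?_)
    fun v w => (pellySupport_add_iff v w).trans (rayCoeff_add_iff v w).symm
  simpa only [IsMinWeight, Set.image_image, dotProduct_natCast_eq_weight] using
    isMinWeight_pellyPolynomial v

section Facets

variable {s s' : Fin (n + 1) → Bool} {T T' : Finset (Fin n)} {S : Set (RayIndex n)}

/-- The positions `j` at which a sign vector (`true` standing for `+`) has signs `+, -` in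
coordinates `j, j + 1`. -/
def descents (s : Fin (n + 1) → Bool) : Finset (Fin n) :=
  {j | s j.castSucc = true ∧ s j.succ = false}

theorem mem_descents {j : Fin n} : j ∈ descents s ↔ s j.castSucc = true ∧ s j.succ = false := by
  simp [descents]

/-- The facet of the complex of compatible sets given by a sign vector `s` and a set `T` of
descents of `s`: it has all rays whose signs agree with `s`, except that of `e_j` for descents
`j ∈ T` and that of `-e_{j+1}` for descents `j ∉ T`. -/
def facet (s : Fin (n + 1) → Bool) (T : Finset (Fin n)) : Set (RayIndex n) :=
  {x | Sum.elim (fun k => s k = true ∧ ∀ j ∈ T, j.castSucc ≠ k)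
    (Sum.elim (fun k => s k = false ∧ ∀ j ∈ descents s \ T, j.succ ≠ k) (· ∈ descents s)) x}

theorem posAt_facet (hT : T ⊆ descents s) (k : Fin (n + 1)) :
    PosAt (rayVector n) (facet s T) k ↔ s k = true := by
  rw [posAt_rayVector_iff]
  constructor
  · rintro (h | ⟨j, rfl, h⟩)
    · exact h.1
    · exact (mem_descents.1 h).1
  · intro h
    by_cases hk : ∃ j ∈ T, j.castSucc = k
    · obtain ⟨j, hj, rfl⟩ := hk
      exact Or.inr ⟨j, rfl, hT hj⟩
    · exact Or.inl ⟨h, fun j hj hjk => hk ⟨j, hj, hjk⟩⟩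

theorem negAt_facet (k : Fin (n + 1)) :
    PosAt (-rayVector n) (facet s T) k ↔ s k = false := by
  rw [posAt_neg_rayVector_iff]
  constructor
  · rintro (h | ⟨j, rfl, h⟩)
    · exact h.1
    · exact (mem_descents.1 h).2
  · intro h
    by_cases hk : ∃ j ∈ descents s \ T, j.succ = k
    · obtain ⟨j, hj, rfl⟩ := hk
      exact Or.inr ⟨j, rfl, (Finset.mem_sdiff.1 hj).1⟩
    · exact Or.inl ⟨h, fun j hj hjk => hk ⟨j, hj, hjk⟩⟩

theorem facet_mem_compatibleSets (hT : T ⊆ descents s) : facet s T ∈ compatibleSets n := by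
  refine ⟨fun k ⟨hpos, hneg⟩ => ?_, fun j ⟨hpos, hneg⟩ => ?_⟩
  · rw [posAt_facet hT] at hpos
    rw [negAt_facet, hpos] at hneg
    exact Bool.noConfusion hneg
  · have hj : j ∈ descents s := mem_descents.2 ⟨hpos.1, hneg.1⟩
    exact hneg.2 j (Finset.mem_sdiff.2 ⟨hj, fun hjT => hpos.2 j hjT rfl⟩) rfl

theorem exists_subset_facet (hS : S ∈ compatibleSets n) :
    ∃ s, ∃ T ⊆ descents s, S ⊆ facet s T := by
  classical
  have hneg : ∀ k, PosAt (-rayVector n) S k → ¬PosAt (rayVector n) S k := fun k h h' =>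
    hS.1 k ⟨h', h⟩
  let s : Fin (n + 1) → Bool := fun k => decide (PosAt (rayVector n) S k)
  have hstrue : ∀ k, s k = true ↔ PosAt (rayVector n) S k := fun k => decide_eq_true_iff
  have hsfalse : ∀ k, PosAt (-rayVector n) S k → s k = false := fun k h =>
    decide_eq_false (hneg k h)
  refine ⟨s, {j ∈ descents s | negIndex j.succ ∈ S}, Finset.filter_subset _ _, ?_⟩
  rintro (k | k | j) h
  · refine ⟨(hstrue k).2 (posAt_rayVector_iff.2 (Or.inl h)), ?_⟩
    rintro j hj rfl
    exact hS.2 j ⟨h, (Finset.mem_filter.1 hj).2⟩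
  · refine ⟨hsfalse k (posAt_neg_rayVector_iff.2 (Or.inl h)), ?_⟩
    rintro j hj rfl
    rw [Finset.mem_sdiff, Finset.mem_filter] at hj
    exact hj.2 ⟨hj.1, h⟩
  · exact mem_descents.2 ⟨(hstrue _).2 (posAt_rayVector_iff.2 (Or.inr ⟨j, rfl, h⟩)),
      hsfalse _ (posAt_neg_rayVector_iff.2 (Or.inr ⟨j, rfl, h⟩))⟩

theorem eq_of_facet_subset (hT : T ⊆ descents s) (hT' : T' ⊆ descents s')
    (hsub : facet s T ⊆ facet s' T') : s = s' ∧ T = T' := by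
  obtain rfl : s = s' := by
    ext k
    cases hk : s k with
    | true => exact ((posAt_facet hT' k).1 (((posAt_facet hT k).2 hk).mono hsub)).symm
    | false => exact ((negAt_facet k).1 (((negAt_facet (T := T) k).2 hk).mono hsub)).symm
  refine ⟨rfl, Finset.Subset.antisymm (fun j hj => ?_) fun j hj => ?_⟩
  · have hmem : negIndex j.succ ∈ facet s T := by
      refine ⟨(mem_descents.1 (hT hj)).2, fun i hi hij => ?_⟩
      rw [Fin.succ_injective n hij] at hi
      exact (Finset.mem_sdiff.1 hi).2 hj
    exact by_contra fun hj' => (hsub hmem).2 j (Finset.mem_sdiff.2 ⟨hT hj, hj'⟩) rfl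
  · by_contra hj'
    have hmem : posIndex j.castSucc ∈ facet s T := by
      refine ⟨(mem_descents.1 (hT' hj)).1, fun i hi hij => hj' ?_⟩
      rwa [Fin.castSucc_injective n hij] at hi
    exact (hsub hmem).2 j hj rfl

theorem maximal_compatibleSets_iff :
    Maximal (· ∈ compatibleSets n) S ↔ ∃ s, ∃ T ⊆ descents s, facet s T = S := by
  constructor
  · intro hS
    obtain ⟨s, T, hT, hsub⟩ := exists_subset_facet hS.1
    exact ⟨s, T, hT, (hS.2 (facet_mem_compatibleSets hT) hsub).antisymm hsub⟩
  · rintro ⟨s, T, hT, rfl⟩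
    refine ⟨facet_mem_compatibleSets hT, fun S' hS' hsub => ?_⟩
    obtain ⟨s', T', hT', hS'T'⟩ := exists_subset_facet hS'
    obtain ⟨rfl, rfl⟩ := eq_of_facet_subset hT hT' (hsub.trans hS'T')
    exact hS'T'

theorem ncard_maximal_compatibleSets_eq_sum (n : ℕ) :
    {S | Maximal (· ∈ compatibleSets n) S}.ncard =
      ∑ s : Fin (n + 1) → Bool, 2 ^ (descents s).card := by
  let D : Finset ((_ : Fin (n + 1) → Bool) × Finset (Fin n)) :=
    Finset.univ.sigma fun s => (descents s).powerset
  have hD : ∀ x, x ∈ D ↔ x.2 ⊆ descents x.1 := by simp [D]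
  let F (x : (_ : Fin (n + 1) → Bool) × Finset (Fin n)) : Set (RayIndex n) := facet x.1 x.2
  have himage : {S | Maximal (· ∈ compatibleSets n) S} = F '' D := by
    ext S
    simp only [F, Set.mem_ofPred_eq, maximal_compatibleSets_iff, Set.mem_image, Finset.mem_coe, hD,
      Sigma.exists]
  have hinj : Set.InjOn F D := fun x hx y hy hxy => by
    obtain ⟨hs, hT⟩ := eq_of_facet_subset ((hD x).1 hx) ((hD y).1 hy) hxy.subset
    exact Sigma.ext hs (heq_of_eq hT)
  rw [himage, hinj.ncard_image, Set.ncard_coe_finset, Finset.card_sigma]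
  simp only [Finset.card_powerset]

end Facets

section Counting

theorem card_descents_cons (b : Bool) (s : Fin (n + 1) → Bool) :
    (descents (Fin.cons b s : Fin (n + 2) → Bool)).card =
      (if b = true ∧ s 0 = false then 1 else 0) + (descents s).card :=
  Fin.card_filter_univ_succ' _

/-- The number of facets whose first sign is `b`. -/
def facetCount (n : ℕ) (b : Bool) : ℕ :=
  ∑ s : Fin n → Bool, 2 ^ (descents (Fin.cons b s : Fin (n + 1) → Bool)).card

theorem sum_fin_succ_bool {M : Type*} [AddCommMonoid M] (f : (Fin (n + 1) → Bool) → M) :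
    ∑ s, f s = ∑ s, f (Fin.cons true s) + ∑ s, f (Fin.cons false s) := by
  rw [← (Fin.consEquiv fun _ => Bool).sum_comp, Fintype.sum_prod_type, Fintype.sum_bool]
  rfl

theorem facetCount_succ_true (n : ℕ) :
    facetCount (n + 1) true = facetCount n true + 2 * facetCount n false := by
  simp only [facetCount, sum_fin_succ_bool (n := n), card_descents_cons, Finset.mul_sum]
  simp [pow_add]

theorem facetCount_succ_false (n : ℕ) :
    facetCount (n + 1) false = facetCount n true + facetCount n false := by
  simp only [facetCount, sum_fin_succ_bool (n := n), card_descents_cons]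
  simp

theorem facetCount_eq_pellNumber (n : ℕ) :
    facetCount n false = pellNumber (n + 1) ∧
      facetCount n true + facetCount n false = pellNumber (n + 2) := by
  induction n with
  | zero => simp [facetCount, descents, pellNumber]
  | succ n ih =>
    refine ⟨(facetCount_succ_false n).trans ih.2, ?_⟩
    rw [pellNumber, ← ih.1, ← ih.2, facetCount_succ_true, facetCount_succ_false]
    ring

theorem ncard_maximal_compatibleSets (n : ℕ) :
    {S | Maximal (· ∈ compatibleSets n) S}.ncard = pellNumber (n + 2) := by
  rw [ncard_maximal_compatibleSets_eq_sum, sum_fin_succ_bool]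
  exact (facetCount_eq_pellNumber n).2

end Counting

end Pellytope

theorem mainTheorem3 (d : ℕ) (hd : 1 ≤ d) :
    Pellytope.IsSimplicialFan (Pellytope.innerNormalFan (Pellytope.pellytope d)) ∧
    Pellytope.rays (Pellytope.innerNormalFan (Pellytope.pellytope d)) =
      (fun v => PointedCone.hull ℝ {v}) '' Pellytope.rayVectors d ∧
    (Pellytope.rays (Pellytope.innerNormalFan (Pellytope.pellytope d))).ncard = 3 * d - 1 ∧
    (Pellytope.maximalCones (Pellytope.innerNormalFan (Pellytope.pellytope d))).ncard =
      Pellytope.pellNumber (d + 1) := by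
  obtain ⟨n, rfl⟩ : ∃ n, d = n + 1 := ⟨d - 1, by omega⟩
  have h := Pellytope.isConicCoordinates_rayVector n
  have hr := Pellytope.singleton_mem_compatibleSets (n := n)
  rw [Pellytope.innerNormalFan_pellytope]
  refine ⟨h.isSimplicialFan, ?_, ?_, ?_⟩
  · rw [h.rays_spannedCones hr, Pellytope.rayVectors_succ, ← Set.range_comp]
    rfl
  · rw [h.ncard_rays_spannedCones hr]
    simp only [Fintype.card_sum, Fintype.card_fin]
    omega
  · rw [h.ncard_maximalCones_spannedCones, Pellytope.ncard_maximal_compatibleSets]
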